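/- Let $k,n\ge 0$ be integers. Let $D^k$ be the group of $k$-jets at $0$ of diffeomorphisms of $\mathbb{R}^n$ fixing $0$, with its usual topology (the derivatives at $0$ of order $\le k$ are coordinates). For an $n$-dimensional manifold $M$ of class $C^k$, let $P^k(M)$ be its $k$-th order frame bundle, i.e. the space of $k$-jets at $0$ of local $C^k$ diffeomorphisms $(\mathbb{R}^n,0)\to M$, topologized by the derivatives of order $\le k$ in charts; $D^k$ acts on it on the right by composition, and every $C^k$ diffeomorphism $f$ of $M$ induces a map $f^k:P^k(M)\to P^k(M)$ by composition on the left. A geometric structure of order $k$ on $M$ consists of a (Hausdorff) manifold $V$ with a continuous left action of $D^k$ and a continuous $D^k$-equivariant map $\omega:P^k(M)\to V$, that is, $\omega(p\cdot g)=g^{-1}\cdot\omega(p)$. Let $\mathrm{Aut}^k(\omega)$ be the group of $C^k$ diffeomorphisms $f$ of $M$ with $\omega\circ f^k=\omega$. For an action of a group $\Gamma$ on $M$ by $C^k$ diffeomorphisms, let $\mathrm{Inn}^k(M,\Gamma)$ be the group of $C^k$ diffeomorphisms $f$ of $M$ such that $f(x)\in\Gamma x$ for every $x\in M$. **Theorem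 (orbit equivalences preserve geometric structures).** Let $M$ be a compact (Hausdorff) manifold with a $C^k$ action of a countable group $\Gamma$ that preserves a geometric structure $\omega$ of order $k$, i.e. every $\gamma\in\Gamma$ acts by an element of $\mathrm{Aut}^k(\omega)$. Then $\mathrm{Inn}^k(M,\Gamma)\subset\mathrm{Aut}^k(\omega)$. -/

import Mathlib

open scoped Manifold ContDiff Topology

noncomputable section

/-! ### Faà di Bruno: the `k`-jet of a composition depends only on the `k`-jets of the factors -/

theorem iteratedFDeriv_comp_congr {E F G : Type*} [NormedAddCommGroup E] [NormedSpace ℝ E]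
    [NormedAddCommGroup F] [NormedSpace ℝ F] [NormedAddCommGroup G] [NormedSpace ℝ G]
    {k : ℕ} {f₁ f₂ : E → F} {g₁ g₂ : F → G} {x : E} {y : F}
    (hx₁ : f₁ x = y) (hx₂ : f₂ x = y)
    (hf₁ : ContDiffAt ℝ k f₁ x) (hf₂ : ContDiffAt ℝ k f₂ x)
    (hg₁ : ContDiffAt ℝ k g₁ y) (hg₂ : ContDiffAt ℝ k g₂ y)
    (hf : ∀ i ≤ k, iteratedFDeriv ℝ i f₁ x = iteratedFDeriv ℝ i f₂ x)
    (hg : ∀ i ≤ k, iteratedFDeriv ℝ i g₁ y = iteratedFDeriv ℝ i g₂ y) :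
    ∀ i ≤ k, iteratedFDeriv ℝ i (g₁ ∘ f₁) x = iteratedFDeriv ℝ i (g₂ ∘ f₂) x := by
  intro i hi
  have hi' : (i : WithTop ℕ∞) ≤ (k : WithTop ℕ∞) := by exact_mod_cast hi
  rw [iteratedFDeriv_comp (by rwa [hx₁]) hf₁ hi', iteratedFDeriv_comp (by rwa [hx₂]) hf₂ hi',
    hx₁, hx₂]
  refine Finset.sum_congr rfl fun c _ => ?_
  have h1 : ftaylorSeries ℝ g₁ y c.length = ftaylorSeries ℝ g₂ y c.length :=
    hg _ (c.length_le.trans hi)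
  have h2 : ∀ j, ftaylorSeries ℝ f₁ x (c.partSize j) = ftaylorSeries ℝ f₂ x (c.partSize j) :=
    fun j => hf _ ((c.partSize_le j).trans hi)
  simp only [FormalMultilinearSeries.compAlongOrderedFinpartition, h1, h2]

/-! ### The group of `C^k` diffeomorphisms -/

/-- `C^k` diffeomorphisms of the `n`-dimensional manifold `M`. -/
abbrev Diff (n : ℕ) (k : WithTop ℕ∞) (M : Type*) [TopologicalSpace M]
    [ChartedSpace (EuclideanSpace ℝ (Fin n)) M] : Type _ :=
  Diffeomorph (𝓡 n) (𝓡 n) M M k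

/-- The group law is composition: `(f * g) x = f (g x)`. -/
instance Diff.instGroup (n : ℕ) (k : WithTop ℕ∞) (M : Type*) [TopologicalSpace M]
    [ChartedSpace (EuclideanSpace ℝ (Fin n)) M] : Group (Diff n k M) where
  mul f g := g.trans f
  one := Diffeomorph.refl _ M k
  inv f := f.symm
  mul_assoc _ _ _ := rfl
  one_mul _ := rfl
  mul_one _ := rfl
  inv_mul_cancel f := by
    apply Diffeomorph.ext
    intro x
    exact f.symm_apply_apply x

/-! ### The group `D^k` of `k`-jets at `0` of diffeomorphisms of `ℝⁿ` fixing `0` -/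

/-- Smooth diffeomorphisms of `ℝⁿ` preserving the origin. -/
def OriginDiff (n : ℕ) : Subgroup (Diff n ∞ (EuclideanSpace ℝ (Fin n))) where
  carrier := {g | g 0 = 0}
  mul_mem' {f g} hf hg := by
    change f (g 0) = 0
    rw [show g 0 = 0 from hg]
    exact hf
  one_mem' := rfl
  inv_mem' {f} hf := by
    change f.symm 0 = 0
    have h := f.symm_apply_apply 0
    rwa [show f 0 = 0 from hf] at h

/-- The diffeomorphisms of `ℝⁿ` fixing `0`, up to equality of all derivatives of order at most `k`
at `0`. -/
def OriginDiff.jetSetoid (n k : ℕ) : Setoid (OriginDiff n) where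
  r f g := ∀ i ≤ k, iteratedFDeriv ℝ i f.1 0 = iteratedFDeriv ℝ i g.1 0
  iseqv := ⟨fun _ _ _ => rfl, fun h i hi => (h i hi).symm,
    fun h h' i hi => (h i hi).trans (h' i hi)⟩

theorem OriginDiff.contDiffAt {n : ℕ} (k : ℕ) (f : OriginDiff n)
    (x : EuclideanSpace ℝ (Fin n)) : ContDiffAt ℝ k f.1 x :=
  (f.1.contMDiff.contDiff.of_le (by exact_mod_cast le_top)).contDiffAt

theorem OriginDiff.jet_mul {n k : ℕ} {f₁ f₂ g₁ g₂ : OriginDiff n}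
    (hf : OriginDiff.jetSetoid n k f₁ f₂) (hg : OriginDiff.jetSetoid n k g₁ g₂) :
    OriginDiff.jetSetoid n k (f₁ * g₁) (f₂ * g₂) :=
  iteratedFDeriv_comp_congr (f₁ := g₁.1) (f₂ := g₂.1) (g₁ := f₁.1) (g₂ := f₂.1) (y := 0) g₁.2 g₂.2
    (OriginDiff.contDiffAt k g₁ 0) (OriginDiff.contDiffAt k g₂ 0) (OriginDiff.contDiffAt k f₁ 0) (OriginDiff.contDiffAt k f₂ 0) hg hf

/-- `D^k`, the group of `k`-jets at `0` of diffeomorphisms of `ℝⁿ` preserving the origin. -/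
def JetGroup (n k : ℕ) : Type := Quotient (OriginDiff.jetSetoid n k)

instance JetGroup.instGroup (n k : ℕ) : Group (JetGroup n k) where
  mul := Quotient.map₂ (· * ·) fun _ _ hf _ _ hg => OriginDiff.jet_mul hf hg
  one := Quotient.mk _ 1
  inv := Quotient.map (·⁻¹) fun f g h => by
    have h1 : OriginDiff.jetSetoid n k (f⁻¹ * g) (f⁻¹ * f) :=
      OriginDiff.jet_mul ((OriginDiff.jetSetoid n k).refl _) ((OriginDiff.jetSetoid n k).symm h)
    have h2 := OriginDiff.jet_mul h1 ((OriginDiff.jetSetoid n k).refl g⁻¹)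
    rw [mul_assoc, mul_inv_cancel, mul_one, inv_mul_cancel, one_mul] at h2
    exact h2
  mul_assoc := by
    rintro ⟨a⟩ ⟨b⟩ ⟨c⟩
    exact congrArg (Quotient.mk _) (mul_assoc a b c)
  one_mul := by
    rintro ⟨a⟩
    exact congrArg (Quotient.mk _) (one_mul a)
  mul_one := by
    rintro ⟨a⟩
    exact congrArg (Quotient.mk _) (mul_one a)
  inv_mul_cancel := by
    rintro ⟨a⟩
    exact congrArg (Quotient.mk _) (inv_mul_cancel a)

/-- The coordinate space of `k`-jets at `0` of maps `ℝⁿ → ℝⁿ`: values and derivatives up to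
order `k`. -/
abbrev JetCoord (n k : ℕ) : Type :=
  (i : Fin (k + 1)) → ContinuousMultilinearMap ℝ
    (fun _ : Fin i => EuclideanSpace ℝ (Fin n)) (EuclideanSpace ℝ (Fin n))

/-- The coordinates of the `k`-jet at `0` of a map `ℝⁿ → ℝⁿ`. -/
def jetCoord (n k : ℕ) (f : EuclideanSpace ℝ (Fin n) → EuclideanSpace ℝ (Fin n)) :
    JetCoord n k :=
  fun i => iteratedFDeriv ℝ i f 0

/-- The coordinates of an element of `D^k`. -/
def JetGroup.coord {n k : ℕ} : JetGroup n k → JetCoord n k :=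
  Quotient.lift (fun f : OriginDiff n => jetCoord n k f.1)
    fun _ _ h => funext fun i => h i (Nat.lt_succ_iff.1 i.2)

/-- The Lie group topology of `D^k`: derivatives of order at most `k` at `0` are coordinates. -/
instance JetGroup.instTopologicalSpace (n k : ℕ) : TopologicalSpace (JetGroup n k) :=
  TopologicalSpace.induced JetGroup.coord inferInstance

/-! ### The `k`-th order frame bundle `P^k(M)` -/

section FrameBundle

variable (n k : ℕ) (M : Type*) [TopologicalSpace M] [ChartedSpace (EuclideanSpace ℝ (Fin n)) M]

/-- Local `C^k` diffeomorphisms from a neighbourhood of `0` in `ℝⁿ` to `M`. -/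
structure LocalParam where
  toOPH : OpenPartialHomeomorph (EuclideanSpace ℝ (Fin n)) M
  zero_mem : 0 ∈ toOPH.source
  contMDiffOn : ContMDiffOn (𝓡 n) (𝓡 n) k toOPH toOPH.source
  contMDiffOn_symm : ContMDiffOn (𝓡 n) (𝓡 n) k toOPH.symm toOPH.target

/-- Equality of `k`-jets at `0`: equal value at `0` and, in charts around it, equal derivatives at
`0` of all orders up to `k`. -/
def LocalParam.jetSetoid : Setoid (LocalParam n k M) where
  r u v := u.toOPH 0 = v.toOPH 0 ∧
    ∀ e ∈ atlas (EuclideanSpace ℝ (Fin n)) M, u.toOPH 0 ∈ e.source →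
      ∀ i ≤ k, iteratedFDeriv ℝ i (e ∘ u.toOPH) 0 = iteratedFDeriv ℝ i (e ∘ v.toOPH) 0
  iseqv := ⟨fun _ => ⟨rfl, fun _ _ _ _ _ => rfl⟩,
    fun h => ⟨h.1.symm, fun e he hx i hi => (h.2 e he (h.1 ▸ hx) i hi).symm⟩,
    fun h h' => ⟨h.1.trans h'.1, fun e he hx i hi =>
      (h.2 e he hx i hi).trans (h'.2 e he (h.1 ▸ hx) i hi)⟩⟩

/-- `P^k(M)`: `k`-jets at `0` of local `C^k` diffeomorphisms `ℝⁿ → M`. -/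
def FrameBundle : Type _ := Quotient (LocalParam.jetSetoid n k M)

/-- The topology of `P^k(M)`: over the domain of a chart `e`, the derivatives at `0` of
orders `0, …, k` of `e ∘ u` are coordinates of the jet of `u`. -/
instance FrameBundle.instTopologicalSpace : TopologicalSpace (FrameBundle n k M) :=
  TopologicalSpace.generateFrom
    {S | ∃ e ∈ atlas (EuclideanSpace ℝ (Fin n)) M, ∃ U : Set (JetCoord n k), IsOpen U ∧
      S = {p | ∃ u : LocalParam n k M, Quotient.mk _ u = p ∧ u.toOPH 0 ∈ e.source ∧
        jetCoord n k (e ∘ u.toOPH) ∈ U}}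

variable {n k M}

/-- `f ∘ u`. -/
def LocalParam.postcomp (f : Diff n k M) (u : LocalParam n k M) : LocalParam n k M where
  toOPH := u.toOPH.transHomeomorph f.toHomeomorph
  zero_mem := u.zero_mem
  contMDiffOn := f.contMDiff.comp_contMDiffOn u.contMDiffOn
  contMDiffOn_symm := u.contMDiffOn_symm.comp f.symm.contMDiff.contMDiffOn fun _ h => h

/-- `u ∘ g`. -/
def LocalParam.precomp (u : LocalParam n k M) (g : OriginDiff n) : LocalParam n k M where
  toOPH := g.1.toHomeomorph.transOpenPartialHomeomorph u.toOPH
  zero_mem := by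
    change g.1 0 ∈ u.toOPH.source
    rw [show g.1 0 = 0 from g.2]
    exact u.zero_mem
  contMDiffOn := u.contMDiffOn.comp
    (g.1.contMDiff.of_le (by exact_mod_cast le_top)).contMDiffOn fun _ h => h
  contMDiffOn_symm :=
    (g.1.symm.contMDiff.of_le (by exact_mod_cast le_top)).comp_contMDiffOn u.contMDiffOn_symm

variable [IsManifold (𝓡 n) k M]

theorem LocalParam.contDiffAt (u : LocalParam n k M)
    {e : OpenPartialHomeomorph M (EuclideanSpace ℝ (Fin n))}
    (he : e ∈ atlas (EuclideanSpace ℝ (Fin n)) M) (h : u.toOPH 0 ∈ e.source) :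
    ContDiffAt ℝ k (e ∘ u.toOPH) 0 := by
  have h1 : ContMDiffAt (𝓡 n) (𝓡 n) k u.toOPH 0 :=
    u.contMDiffOn.contMDiffAt (u.toOPH.open_source.mem_nhds u.zero_mem)
  have h2 : ContMDiffAt (𝓡 n) (𝓡 n) k e (u.toOPH 0) :=
    (contMDiffOn_of_mem_maximalAtlas
      (IsManifold.subset_maximalAtlas he)).contMDiffAt (e.open_source.mem_nhds h)
  exact (h2.comp 0 h1).contDiffAt

theorem LocalParam.jet_postcomp (f : Diff n k M) {u v : LocalParam n k M}
    (h : LocalParam.jetSetoid n k M u v) :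
    LocalParam.jetSetoid n k M (u.postcomp f) (v.postcomp f) := by
  refine ⟨congrArg f h.1, fun e he hx => ?_⟩
  change f (u.toOPH 0) ∈ e.source at hx
  set c := chartAt (EuclideanSpace ℝ (Fin n)) (u.toOPH 0) with hc
  have hca := chart_mem_atlas (EuclideanSpace ℝ (Fin n)) (u.toOPH 0)
  have hcs : u.toOPH 0 ∈ c.source := mem_chart_source _ _
  have hcs' : v.toOPH 0 ∈ c.source := h.1 ▸ hcs
  -- the local expression of `f` in the charts `c` and `e`
  have hF : ContDiffAt ℝ k (e ∘ f ∘ c.symm) (c (u.toOPH 0)) := by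
    have h1 : ContMDiffAt (𝓡 n) (𝓡 n) k c.symm (c (u.toOPH 0)) :=
      (contMDiffOn_symm_of_mem_maximalAtlas (IsManifold.subset_maximalAtlas hca)).contMDiffAt
        (c.open_target.mem_nhds (c.map_source hcs))
    have h2 : ContMDiffAt (𝓡 n) (𝓡 n) k e (f (c.symm (c (u.toOPH 0)))) := by
      rw [c.left_inv hcs]
      exact (contMDiffOn_of_mem_maximalAtlas
        (IsManifold.subset_maximalAtlas he)).contMDiffAt (e.open_source.mem_nhds hx)
    have h3 : ContMDiffAt (𝓡 n) (𝓡 n) k (f ∘ c.symm) (c (u.toOPH 0)) :=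
      f.contMDiff.contMDiffAt.comp _ h1
    exact (ContMDiffAt.comp (g := e) (f := f ∘ c.symm) _ h2 h3).contDiffAt
  have key : ∀ w : LocalParam n k M, w.toOPH 0 ∈ c.source →
      (e ∘ f ∘ w.toOPH) =ᶠ[𝓝 0] ((e ∘ f ∘ c.symm) ∘ (c ∘ w.toOPH)) := fun w hw => by
    filter_upwards [(w.toOPH.continuousAt w.zero_mem).preimage_mem_nhds
      (c.open_source.mem_nhds hw)] with t ht
    simp only [Function.comp_apply]
    rw [c.left_inv ht]
  intro i hi
  refine ((key u hcs).iteratedFDeriv (𝕜 := ℝ) i).eq_of_nhds.trans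
    (Eq.trans ?_ ((key v hcs').iteratedFDeriv (𝕜 := ℝ) i).eq_of_nhds.symm)
  exact iteratedFDeriv_comp_congr rfl (by simp [h.1]) (u.contDiffAt hca hcs)
    (v.contDiffAt hca hcs') hF hF (h.2 c hca hcs) (fun _ _ => rfl) i hi

theorem LocalParam.jet_precomp {u v : LocalParam n k M} {g g' : OriginDiff n}
    (h : LocalParam.jetSetoid n k M u v) (hg : OriginDiff.jetSetoid n k g g') :
    LocalParam.jetSetoid n k M (u.precomp g) (v.precomp g') := by
  have hu : (u.precomp g).toOPH 0 = u.toOPH 0 := congrArg u.toOPH g.2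
  have hv : (v.precomp g').toOPH 0 = v.toOPH 0 := congrArg v.toOPH g'.2
  refine ⟨hu.trans (h.1.trans hv.symm), fun e he hx => ?_⟩
  rw [hu] at hx
  exact iteratedFDeriv_comp_congr (f₁ := g.1) (f₂ := g'.1) (g₁ := e ∘ u.toOPH)
    (g₂ := e ∘ v.toOPH) (y := 0) g.2 g'.2 (OriginDiff.contDiffAt k g 0) (OriginDiff.contDiffAt k g' 0)
    (u.contDiffAt he hx) (v.contDiffAt he (h.1 ▸ hx)) hg (h.2 e he hx)

/-- A `C^k` diffeomorphism `f` acts on `P^k(M)` by composition on the left. -/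
instance FrameBundle.instMulAction : MulAction (Diff n k M) (FrameBundle n k M) where
  smul f := Quotient.map (LocalParam.postcomp f) fun _ _ h => LocalParam.jet_postcomp f h
  one_smul := by
    rintro ⟨u⟩
    exact Quotient.sound ((LocalParam.jetSetoid n k M).refl _)
  mul_smul f g := by
    rintro ⟨u⟩
    exact Quotient.sound ((LocalParam.jetSetoid n k M).refl _)

/-- The structure group `D^k` acts on `P^k(M)` on the right, by composition. -/
instance FrameBundle.instMulActionJetGroup :
    MulAction (JetGroup n k)ᵐᵒᵖ (FrameBundle n k M) where
  smul g p := Quotient.map₂ LocalParam.precomp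
    (fun _ _ h _ _ hg => LocalParam.jet_precomp h hg) p g.unop
  one_smul := by
    rintro ⟨u⟩
    exact Quotient.sound ((LocalParam.jetSetoid n k M).refl _)
  mul_smul := by
    rintro ⟨⟨f⟩⟩ ⟨⟨g⟩⟩ ⟨u⟩
    exact Quotient.sound ((LocalParam.jetSetoid n k M).refl _)

end FrameBundle

/-! ### Geometric structures and inner orbit equivalences -/

/-- A geometric structure of order `k` on `M` with values in the `D^k`-space `V`: a continuous
`D^k`-equivariant map `σ : P^k(M) → V`. As `D^k` acts on `P^k(M)` on the right and on `V` on the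
left, equivariance reads `σ (p · g) = g⁻¹ • σ p`. -/
structure GeometricStructure (n k : ℕ) (M : Type*) [TopologicalSpace M]
    [ChartedSpace (EuclideanSpace ℝ (Fin n)) M] [IsManifold (𝓡 n) k M]
    (V : Type*) [TopologicalSpace V] [MulAction (JetGroup n k) V] where
  toFun : FrameBundle n k M → V
  continuous_toFun : Continuous toFun
  equivariant : ∀ (g : JetGroup n k) (p : FrameBundle n k M),
    toFun (MulOpposite.op g • p) = g⁻¹ • toFun p

/-- `Aut^k(σ)`: the `C^k` diffeomorphisms `f` of `M` that preserve `σ`, i.e. `σ ∘ f^k = σ` where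
`f^k` is the map induced by `f` on `P^k(M)`. -/
def GeometricStructure.Aut {n k : ℕ} {M : Type*} [TopologicalSpace M]
    [ChartedSpace (EuclideanSpace ℝ (Fin n)) M] [IsManifold (𝓡 n) k M]
    {V : Type*} [TopologicalSpace V] [MulAction (JetGroup n k) V]
    (σ : GeometricStructure n k M V) : Subgroup (Diff n k M) where
  carrier := {f | ∀ p : FrameBundle n k M, σ.toFun (f • p) = σ.toFun p}
  mul_mem' {f g} hf hg p := by rw [mul_smul, hf, hg]
  one_mem' p := by rw [one_smul]
  inv_mem' {f} hf p := by rw [← hf (f⁻¹ • p), smul_inv_smul]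

/-- `Inn^k(M, Γ)`: the `C^k` diffeomorphisms of `M` sending every point `x` to a point of its
orbit `Γx`. -/
def Inn {n k : ℕ} {M : Type*} [TopologicalSpace M]
    [ChartedSpace (EuclideanSpace ℝ (Fin n)) M] {Γ : Type*} [Group Γ]
    (ρ : Γ →* Diff n k M) : Subgroup (Diff n k M) where
  carrier := {f | ∀ x, ∃ γ, f x = ρ γ x}
  mul_mem' {f g} hf hg x := by
    obtain ⟨a, ha⟩ := hg x
    obtain ⟨b, hb⟩ := hf (g x)
    refine ⟨b * a, ?_⟩
    rw [map_mul]
    change f (g x) = ρ b (ρ a x)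
    rw [hb, ha]
  one_mem' x := ⟨1, by rw [map_one]⟩
  inv_mem' {f} hf x := by
    obtain ⟨a, ha⟩ := hf (f.symm x)
    refine ⟨a⁻¹, ?_⟩
    rw [map_inv]
    change f.symm x = (ρ a).symm x
    rw [Diffeomorph.apply_symm_apply] at ha
    conv_rhs => rw [ha]
    exact ((ρ a).symm_apply_apply _).symm

end

open scoped Manifold ContDiff Topology

noncomputable section

/-! If `f` agrees with some `ρ γ` on a neighbourhood of a point, the two have the same `k`-jet
there, so `f` preserves `σ` on all frames at that point (`FrameBundle.smul_jet_congr`). Such points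
are dense by Baire: the closed sets where `f = ρ γ` are countably many and cover `M`, so the union
of their interiors is dense (`Inn.dense_eventuallyEq`). Density in `M` must then be lifted to
frames. A frame, the jet of `u` at `0`, extends to the continuous family of jets of `t ↦ u (t + x)`,
based at the points `u x` (`LocalParam.tendsto_jet_translate`). It is thus a limit of frames at good
points, and the equality `σ ∘ f^k = σ` passes to the limit since `V` is Hausdorff. -/

section Translate

variable {n k : ℕ} {M : Type*} [TopologicalSpace M] [ChartedSpace (EuclideanSpace ℝ (Fin n)) M]

/-- The local parametrization `t ↦ u (t + x)`, for a point `x` of the domain of `u`. -/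
def LocalParam.translate (u : LocalParam n k M) (x : u.toOPH.source) : LocalParam n k M where
  toOPH := (Homeomorph.addRight (x : EuclideanSpace ℝ (Fin n))).transOpenPartialHomeomorph u.toOPH
  zero_mem := by
    change (0 : EuclideanSpace ℝ (Fin n)) + x ∈ u.toOPH.source
    rw [zero_add]
    exact x.2
  contMDiffOn := by
    have h : ContDiff ℝ k fun t : EuclideanSpace ℝ (Fin n) => t + x := by fun_prop
    exact u.contMDiffOn.comp h.contMDiff.contMDiffOn fun _ h => h
  contMDiffOn_symm := by
    have h : ContDiff ℝ k fun t : EuclideanSpace ℝ (Fin n) => t + -x := by fun_prop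
    exact h.contMDiff.comp_contMDiffOn u.contMDiffOn_symm

theorem LocalParam.translate_apply (u : LocalParam n k M) (x : u.toOPH.source)
    (t : EuclideanSpace ℝ (Fin n)) : (u.translate x).toOPH t = u.toOPH (t + x) :=
  rfl

/-- The `k`-jet at `0` of a local parametrization, as a point of the frame bundle. -/
def LocalParam.jet (u : LocalParam n k M) : FrameBundle n k M :=
  Quotient.mk _ u

/-- The jet of `t ↦ u (t + x)` depends continuously on `x` at `x = 0`. -/
theorem LocalParam.tendsto_jet_translate [IsManifold (𝓡 n) k M] (u : LocalParam n k M) :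
    Filter.Tendsto (fun x => (u.translate x).jet) (𝓝 ⟨0, u.zero_mem⟩) (𝓝 u.jet) := by
  refine TopologicalSpace.tendsto_nhds_generateFrom_iff.2 ?_
  rintro _ ⟨e, he, U, hU, rfl⟩ ⟨w, hw, hws, hwU⟩
  -- Membership in a subbasic open set is witnessed by some representative `w` of the jet; its chart
  -- data are carried over to `u`.
  have hwu : LocalParam.jetSetoid n k M w u := Quotient.exact hw
  have hus : u.toOPH 0 ∈ e.source := hwu.1 ▸ hws
  have huU : jetCoord n k (e ∘ u.toOPH) ∈ U := by
    convert hwU using 1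
    funext i
    exact (hwu.2 e he hws i (Nat.lt_succ_iff.1 i.2)).symm
  -- Derivatives of order at most `k` of a `C^k` map vary continuously with the point; those at `x`
  -- are the coordinates of the translated jet.
  have hjet : ContinuousAt
      (fun x : EuclideanSpace ℝ (Fin n) =>
        (fun i => iteratedFDeriv ℝ i (e ∘ u.toOPH) x : JetCoord n k)) 0 := by
    refine continuousAt_pi.2 fun i => ?_
    have hi : ((i : ℕ) : WithTop ℕ∞) ≤ (k : WithTop ℕ∞) := by
      exact_mod_cast Nat.lt_succ_iff.1 i.2
    exact (u.contDiffAt he hus).continuousAt_iteratedFDeriv hi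
  have hev : ∀ᶠ x in 𝓝 (0 : EuclideanSpace ℝ (Fin n)), u.toOPH x ∈ e.source ∧
      (fun i => iteratedFDeriv ℝ i (e ∘ u.toOPH) x : JetCoord n k) ∈ U :=
    ((u.toOPH.continuousAt u.zero_mem).eventually (e.open_source.mem_nhds hus)).and
      (hjet.eventually (hU.mem_nhds huU))
  have hval : Filter.Tendsto (Subtype.val : u.toOPH.source → EuclideanSpace ℝ (Fin n))
      (𝓝 ⟨0, u.zero_mem⟩) (𝓝 0) := continuous_subtype_val.continuousAt
  filter_upwards [hval.eventually hev] with x hx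
  refine ⟨u.translate x, rfl, ?_, ?_⟩
  · rw [LocalParam.translate_apply, zero_add]
    exact hx.1
  · convert hx.2 using 1
    funext i
    change iteratedFDeriv ℝ i (fun t => (e ∘ u.toOPH) (t + x)) 0 = _
    rw [iteratedFDeriv_comp_add_right, zero_add]

/-- Diffeomorphisms that agree near the base point of a frame act on it in the same way. -/
theorem FrameBundle.smul_jet_congr [IsManifold (𝓡 n) k M] {f g : Diff n k M} {u : LocalParam n k M}
    (h : f =ᶠ[𝓝 (u.toOPH 0)] g) :
    f • u.jet = g • u.jet := by
  refine Quotient.sound ⟨h.eq_of_nhds, fun e _ _ i _ => ?_⟩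
  have h' : (e ∘ f ∘ u.toOPH) =ᶠ[𝓝 0] (e ∘ g ∘ u.toOPH) := by
    filter_upwards [(u.toOPH.continuousAt u.zero_mem).eventually h] with t ht
    simp only [Function.comp_apply, ht]
  exact (h'.iteratedFDeriv (𝕜 := ℝ) i).eq_of_nhds

end Translate

/-- An inner orbit equivalence of a countable group agrees locally with an element of the group
on a dense set of points. -/
theorem Inn.dense_eventuallyEq {n k : ℕ} {M : Type*} [TopologicalSpace M] [T2Space M] [BaireSpace M]
    [ChartedSpace (EuclideanSpace ℝ (Fin n)) M] {Γ : Type*} [Group Γ] [Countable Γ]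
    {ρ : Γ →* Diff n k M} {f : Diff n k M} (hf : f ∈ Inn ρ) :
    Dense {x | ∃ γ, f =ᶠ[𝓝 x] ρ γ} := by
  have hd : Dense (⋃ γ, interior {x | f x = ρ γ x}) :=
    dense_iUnion_interior_of_closed
      (fun γ => isClosed_eq f.continuous (ρ γ).continuous)
      (Set.eq_univ_of_forall fun x => Set.mem_iUnion.2 (hf x))
  refine hd.mono fun x hx => ?_
  obtain ⟨γ, hγ⟩ := Set.mem_iUnion.1 hx
  exact ⟨γ, mem_interior_iff_mem_nhds.1 hγ⟩

end

/-- Let a countable group `Γ` act by `C^k` diffeomorphisms on the compact manifold `M`, preserving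
the geometric structure `σ : P^k(M) → V` of order `k`, where `V` is a (Hausdorff) manifold with a
continuous action of `D^k`. Then `Inn^k(M, Γ) ⊆ Aut^k(σ)`. -/
theorem mainTheorem7 {n k m : ℕ}
    {M : Type*} [TopologicalSpace M] [T2Space M] [CompactSpace M]
    [ChartedSpace (EuclideanSpace ℝ (Fin n)) M] [IsManifold (𝓡 n) k M]
    {V : Type*} [TopologicalSpace V] [T2Space V] [ChartedSpace (EuclideanSpace ℝ (Fin m)) V]
    [MulAction (JetGroup n k) V] [ContinuousSMul (JetGroup n k) V]
    (σ : GeometricStructure n k M V)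
    {Γ : Type*} [Group Γ] [Countable Γ] (ρ : Γ →* Diff n k M)
    (hσ : ρ.range ≤ σ.Aut) :
    Inn ρ ≤ σ.Aut := by
  rintro f hf ⟨u⟩
  -- `M` is Baire, being compact Hausdorff, and dense sets pull back to dense sets along open maps.
  have hdense : Dense {x : u.toOPH.source | ∃ γ, f =ᶠ[𝓝 (u.toOPH x)] ρ γ} :=
    (Inn.dense_eventuallyEq hf).preimage u.toOPH.isOpenEmbedding_restrict.isOpenMap
  set S := {x : u.toOPH.source | ∃ γ, f =ᶠ[𝓝 (u.toOPH x)] ρ γ}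
  -- The point `0` need not lie in `S`, but it is in the closure, so limits along `S` at `0` are
  -- unique.
  have hne : (𝓝[S] (⟨0, u.zero_mem⟩ : u.toOPH.source)).NeBot :=
    mem_closure_iff_nhdsWithin_neBot.1 (hdense _)
  have hlim : Filter.Tendsto (fun x => σ.toFun (u.translate x).jet) (𝓝[S] ⟨0, u.zero_mem⟩)
      (𝓝 (σ.toFun u.jet)) :=
    ((σ.continuous_toFun.tendsto _).comp u.tendsto_jet_translate).mono_left nhdsWithin_le_nhds
  have hlim' : Filter.Tendsto (fun x => σ.toFun (f • (u.translate x).jet))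
      (𝓝[S] ⟨0, u.zero_mem⟩) (𝓝 (σ.toFun (f • u.jet))) :=
    -- Composing with `f` on the left commutes definitionally with translating the source.
    ((σ.continuous_toFun.tendsto _).comp (u.postcomp f).tendsto_jet_translate).mono_left
      nhdsWithin_le_nhds
  have heq : (fun x => σ.toFun (f • (u.translate x).jet)) =ᶠ[𝓝[S] ⟨0, u.zero_mem⟩]
      fun x => σ.toFun (u.translate x).jet := by
    filter_upwards [self_mem_nhdsWithin] with x ⟨γ, hγ⟩
    have h : f =ᶠ[𝓝 ((u.translate x).toOPH 0)] ρ γ := by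
      rwa [LocalParam.translate_apply, zero_add]
    exact (congrArg σ.toFun (FrameBundle.smul_jet_congr h)).trans (hσ ⟨γ, rfl⟩ _)
  exact tendsto_nhds_unique_of_eventuallyEq hlim' hlim heq
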